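/- Theorem 5.1 (GPFT). Let $M=(m_{ij})$ be an $n\times n$ matrix with non-negative real entries (for instance a non-negative integer matrix) which is in primitive Frobenius form: the index set $\{1,\dots,n\}$ is partitioned into consecutive non-empty blocks $B_1,\dots,B_k$ such that $M$ is lower block-triangular, i.e. $m_{ij}=0$ whenever the block of $i$ strictly precedes the block of $j$, and each diagonal block $(m_{ij})_{i,j\in B_a}$ is either primitive (some positive power of it has only strictly positive entries) or is the $1\times 1$ zero matrix. Assume that $M$ has no zero column. Then for every vector $\vec v\in\mathbb R^n$ with non-negative entries and $\vec v\neq\vec 0$ there exist a function $h_{\vec v}:\mathbb N\to\mathbb R$ and a vector $\vec v_\infty\in\mathbb R^n$, $\vec v_\infty\neq\vec 0$, such that $$\lim_{t\to\infty}\frac{M^t\vec v}{h_{\vec v}(t)}=\vec v_\infty$$ (that is, $h_{\vec v}$ is a normalization function for the family $(M^t\vec v)_{t\in\mathbb N}$), and $\vec v_\infty$ is an eigenvector of $M$. -/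

import Mathlib

open Filter Topology
open scoped Matrix

/-- `M` is in primitive Frobenius form with respect to the partition of the rows and columns into
the `k` consecutive non-empty blocks `{i | b i = a}`, `a : Fin k`: it is lower block triangular
(the entry `M i j` vanishes whenever the block of `i` comes strictly before the block of `j`),
and every diagonal block is primitive or is the `1 × 1` zero matrix. -/
structure IsPrimitiveFrobenius {n k : ℕ} (M : Matrix (Fin n) (Fin n) ℝ) (b : Fin n → Fin k) :
    Prop where
  monotone : Monotone b
  surjective : Function.Surjective b
  lower_triangular : ∀ i j, b i < b j → M i j = 0
  diagonal : ∀ a : Fin k, (M.toSquareBlock b a).IsPrimitive ∨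
    (Fintype.card {i // b i = a} = 1 ∧ M.toSquareBlock b a = 0)

/-- `h` is a normalization function for the family `u` with limit vector `w`: the vectors
`u t / h t` converge to `w`, and `w ≠ 0`. (As `w ≠ 0`, this forces `h t ≠ 0` for all large `t`, so
the convention for division by zero plays no role.) -/
def IsNormalizationWithLimit {n : ℕ} (h : ℕ → ℝ) (u : ℕ → Fin n → ℝ) (w : Fin n → ℝ) : Prop :=
  w ≠ 0 ∧ Tendsto (fun t => (h t)⁻¹ • u t) atTop (𝓝 w)

/-! Each coordinate of `M ^ t *ᵥ v` either vanishes eventually or is asymptotic to a positive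
multiple of some scale `binomGrowth d t * r ^ t` with `0 < r` (`RegularGrowth`). Any two scales are
equal or one is negligible against the other, so each coordinate divided by the coordinate sum
converges. The limit has coordinate sum 1, and applying `M` once more shows that it is an
eigenvector.

Regular growth is proved by induction on blocks. A block with matrix `P` satisfies `y (t + 1) = P *ᵥ
y t + g t`, where `g` collects the earlier blocks. Variation of constants expresses `y` through
Cauchy products of `g` with entries of `P ^ s`, which are asymptotic to positive multiples of `r ^
s` by Perron–Frobenius. In such a product the larger exponential rate wins, and equal rates raise
the degree by one (`RegularGrowth.cauchyProd`). Nonnegativity rules out cancellation throughout. -/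

namespace Matrix

/-! ### Perron–Frobenius asymptotics for primitive matrices -/

variable {ι : Type*} [Fintype ι]

theorem mulVec_nonneg_of_nonneg {A : Matrix ι ι ℝ} (hA : ∀ i j, 0 ≤ A i j) {x : ι → ℝ}
    (hx : ∀ i, 0 ≤ x i) (i : ι) : 0 ≤ (A *ᵥ x) i :=
  Finset.sum_nonneg fun j _ => mul_nonneg (hA i j) (hx j)

theorem mulVec_pos_of_pos {A : Matrix ι ι ℝ} (hA : ∀ i j, 0 < A i j) {x : ι → ℝ}
    (hx : ∀ i, 0 ≤ x i) (hx0 : x ≠ 0) (i : ι) : 0 < (A *ᵥ x) i := by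
  obtain ⟨j, hj⟩ := Function.ne_iff.1 hx0
  exact Finset.sum_pos' (fun j _ => mul_nonneg (hA i j).le (hx j))
    ⟨j, Finset.mem_univ j, mul_pos (hA i j) (lt_of_le_of_ne (hx j) (Ne.symm hj))⟩

variable [DecidableEq ι]

/-- The Collatz–Wielandt argument: a primitive matrix has a positive eigenvalue with a strictly
positive eigenvector. -/
theorem IsPrimitive.exists_pos_eigenvector [Nonempty ι] {P : Matrix ι ι ℝ}
    (hP : P.IsPrimitive) :
    ∃ r : ℝ, 0 < r ∧ ∃ e : ι → ℝ, (∀ i, 0 < e i) ∧ P *ᵥ e = r • e := by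
  obtain ⟨hnn, m, hm, hpos⟩ := hP
  set R : ℝ := ∑ i, ∑ j, P i j
  -- The eigenvalue is the largest `s` with `s • x ≤ P *ᵥ x` for some `x` in the simplex; the cap
  -- `R` costs nothing by `hbound` and makes `C` compact.
  let C : Set ((ι → ℝ) × ℝ) :=
    (stdSimplex ℝ ι ×ˢ Set.Icc 0 R) ∩ {p | ∀ i, p.2 * p.1 i ≤ (P *ᵥ p.1) i}
  have hbound : ∀ (x : ι → ℝ) (s : ℝ), x ∈ stdSimplex ℝ ι → (∀ i, s * x i ≤ (P *ᵥ x) i) →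
      s ≤ R := by
    intro x s hx h
    calc s = ∑ i, s * x i := by rw [← Finset.mul_sum, hx.2, mul_one]
      _ ≤ ∑ i, (P *ᵥ x) i := Finset.sum_le_sum fun i _ => h i
      _ ≤ R := Finset.sum_le_sum fun i _ => Finset.sum_le_sum fun j _ =>
        mul_le_of_le_one_right (hnn i j) (hx.2 ▸ Finset.single_le_sum
          (f := x) (fun k _ => hx.1 k) (Finset.mem_univ j))
  have hC : IsCompact C := by
    refine ((isCompact_stdSimplex ℝ ι).prod isCompact_Icc).inter_right ?_
    simp only [Set.ofPred_forall]
    refine isClosed_iInter fun i => isClosed_le (by fun_prop) ?_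
    simp only [mulVec, dotProduct]
    fun_prop
  have hne : C.Nonempty := by
    have i0 := Classical.arbitrary ι
    have hx : Pi.single i0 (1 : ℝ) ∈ stdSimplex ℝ ι := single_mem_stdSimplex ℝ i0
    refine ⟨(Pi.single i0 1, 0), ⟨hx, le_rfl, ?_⟩, ?_⟩
    · exact Finset.sum_nonneg fun i _ => Finset.sum_nonneg fun j _ => hnn i j
    · intro i
      simpa using mulVec_nonneg_of_nonneg hnn hx.1 i
  obtain ⟨⟨x, r⟩, ⟨⟨hx, hr⟩, hxr⟩, hmax⟩ := hC.exists_isMaxOn hne continuous_snd.continuousOn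
  simp only [Set.mem_ofPred_eq] at hx hr hxr
  have hx0 : x ≠ 0 := by
    rintro rfl
    simpa using hx.2
  have heig : P *ᵥ x = r • x := by
    by_contra hcon
    have hz : ∀ i, 0 ≤ (P *ᵥ x - r • x) i := fun i => by simpa using hxr i
    have hy := mulVec_pos_of_pos hpos hx.1 hx0
    have hPz := mulVec_pos_of_pos hpos hz (sub_ne_zero.2 hcon)
    -- Applying `P ^ m` makes the defect strictly positive everywhere, so `y` admits a quotient `q >
    -- r`, against maximality.
    set y := P ^ m *ᵥ x
    have hcomm : P ^ m *ᵥ (P *ᵥ x - r • x) = P *ᵥ y - r • y := by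
      rw [mulVec_sub, mulVec_smul, mulVec_mulVec, mulVec_mulVec, ← pow_succ, ← pow_succ']
    rw [hcomm] at hPz
    obtain ⟨k, hk⟩ := Finite.exists_min fun i => (P *ᵥ y) i / y i
    set q := (P *ᵥ y) k / y k
    have hrq : r < q := by
      rw [lt_div_iff₀ (hy k)]
      simpa using hPz k
    set σ := ∑ i, y i
    have hσ : 0 < σ := Finset.sum_pos (fun i _ => hy i) Finset.univ_nonempty
    have hyS : σ⁻¹ • y ∈ stdSimplex ℝ ι := by
      refine ⟨fun i => mul_nonneg (inv_nonneg.2 hσ.le) (hy i).le, ?_⟩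
      simp only [Pi.smul_apply, smul_eq_mul, ← Finset.mul_sum]
      exact inv_mul_cancel₀ hσ.ne'
    have hyq : ∀ i, q * (σ⁻¹ • y) i ≤ (P *ᵥ (σ⁻¹ • y)) i := by
      intro i
      have h1 : q * y i ≤ (P *ᵥ y) i := (le_div_iff₀ (hy i)).1 (hk i)
      rw [mulVec_smul]
      simp only [Pi.smul_apply, smul_eq_mul]
      calc q * (σ⁻¹ * y i) = σ⁻¹ * (q * y i) := by ring
        _ ≤ _ := mul_le_mul_of_nonneg_left h1 (inv_nonneg.2 hσ.le)
    have hmem : (σ⁻¹ • y, q) ∈ C := ⟨⟨hyS, (hr.1.trans hrq.le), hbound _ _ hyS hyq⟩, hyq⟩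
    exact absurd (hmax hmem) (not_le.2 hrq)
  have hpow : ∀ t : ℕ, P ^ t *ᵥ x = r ^ t • x := by
    intro t
    induction t with
    | zero => simp
    | succ t ih => rw [pow_succ, ← mulVec_mulVec, heig, mulVec_smul, ih, smul_smul, pow_succ']
  have hxpos : ∀ i, 0 < r ^ m * x i := fun i => by
    have := mulVec_pos_of_pos hpos hx.1 hx0 i
    rwa [hpow] at this
  have hr0 : r ≠ 0 := by
    rintro rfl
    simpa [hm.ne'] using hxpos (Classical.arbitrary ι)
  have hrpos := lt_of_le_of_ne hr.1 hr0.symm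
  exact ⟨r, hrpos, x, fun i => (mul_pos_iff_of_pos_left (pow_pos hrpos m)).1 (hxpos i), heig⟩

/-- The orbits of a primitive stochastic matrix converge to constant vectors. -/
theorem tendsto_pow_mulVec_of_stochastic [Nonempty ι] {Q : Matrix ι ι ℝ} (hQ : Q.IsPrimitive)
    (hone : ∀ i, ∑ j, Q i j = 1) (u : ι → ℝ) {δ : ℝ} (hδ : ∀ i, δ ≤ u i) :
    ∃ c, δ ≤ c ∧ ∀ i, Tendsto (fun t : ℕ => (Q ^ t *ᵥ u) i) atTop (𝓝 c) := by
  obtain ⟨hnn, m, hm, hpos⟩ := hQ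
  have hnn' : ∀ t i j, 0 ≤ (Q ^ t) i j := fun t i j => pow_apply_nonneg hnn t i j
  have hone' : ∀ t i, ∑ j, (Q ^ t) i j = 1 := by
    have h1 : Q *ᵥ 1 = 1 := funext fun i => by simp [mulVec, dotProduct, hone i]
    have : ∀ t : ℕ, Q ^ t *ᵥ 1 = 1 := fun t => by
      induction t with
      | zero => simp
      | succ t ih => rw [pow_succ, ← mulVec_mulVec, h1, ih]
    intro t i
    simpa [mulVec, dotProduct] using congrFun (this t) i
  set w : ℕ → ι → ℝ := fun t => Q ^ t *ᵥ u
  have hstep : ∀ s t, w (s + t) = Q ^ s *ᵥ w t := fun s t => by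
    simp only [w, mulVec_mulVec, pow_add]
  set X : ℕ → ℝ := fun t => ⨆ i, w t i
  set N : ℕ → ℝ := fun t => ⨅ i, w t i
  have hX : ∀ t i, w t i ≤ X t := fun t i => le_ciSup (Set.finite_range _).bddAbove i
  have hN : ∀ t i, N t ≤ w t i := fun t i => ciInf_le (Set.finite_range _).bddBelow i
  -- Rows sum to 1, so the new deficit below the maximum is an average of the old ones and is at
  -- least any single term.
  have hgap : ∀ s t i l, (Q ^ s) i l * (X t - w t l) ≤ X t - w (s + t) i := by
    intro s t i l
    have : X t - w (s + t) i = ∑ j, (Q ^ s) i j * (X t - w t j) := by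
      simp only [mul_sub, Finset.sum_sub_distrib, ← Finset.sum_mul, hone', one_mul, hstep]
      rfl
    rw [this]
    exact Finset.single_le_sum (f := fun j => (Q ^ s) i j * (X t - w t j))
      (fun j _ => mul_nonneg (hnn' s i j) (sub_nonneg.2 (hX t j))) (Finset.mem_univ l)
  have hXanti : Antitone X := by
    refine antitone_nat_of_succ_le fun t => ciSup_le fun i => ?_
    have := (mul_nonneg (hnn' 1 i i) (sub_nonneg.2 (hX t i))).trans (hgap 1 t i i)
    rw [add_comm] at this
    linarith
  have hNmono : Monotone N := by
    refine monotone_nat_of_le_succ fun t => le_ciInf fun i => ?_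
    rw [add_comm, hstep]
    calc N t = ∑ j, (Q ^ 1) i j * N t := by rw [← Finset.sum_mul, hone', one_mul]
      _ ≤ _ := Finset.sum_le_sum fun j _ => mul_le_mul_of_nonneg_left (hN t j) (hnn' 1 i j)
  have hNX : ∀ t, N t ≤ X t := fun t => (hN t (Classical.arbitrary ι)).trans (hX t _)
  have hXlim := tendsto_atTop_ciInf hXanti
    ⟨N 0, by rintro _ ⟨t, rfl⟩; exact (hNmono (Nat.zero_le t)).trans (hNX t)⟩
  have hNlim := tendsto_atTop_ciSup hNmono
    ⟨X 0, by rintro _ ⟨t, rfl⟩; exact (hNX t).trans (hXanti (Nat.zero_le t))⟩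
  set x := ⨅ t, X t
  set n := ⨆ t, N t
  obtain ⟨⟨i0, l0⟩, hmin⟩ := Finite.exists_min fun p : ι × ι => (Q ^ m) p.1 p.2
  set ε := (Q ^ m) i0 l0
  -- Every row of `Q ^ m` gives weight at least `ε` to the index where `w t` is minimal.
  have hcontract : ∀ t, X (m + t) ≤ X t - ε * (X t - N t) := by
    intro t
    refine ciSup_le fun i => ?_
    obtain ⟨l, hl⟩ := exists_eq_ciInf_of_finite (f := w t)
    have h1 := hgap m t i l
    have h2 : ε * (X t - N t) ≤ (Q ^ m) i l * (X t - w t l) := by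
      rw [hl]
      exact mul_le_mul_of_nonneg_right (hmin (i, l)) (sub_nonneg.2 (hNX t))
    linarith
  have hle : x ≤ x - ε * (x - n) := by
    refine le_of_tendsto_of_tendsto' ?_ (hXlim.sub ((hXlim.sub hNlim).const_mul ε)) hcontract
    exact hXlim.comp (tendsto_atTop_mono (fun t => Nat.le_add_left t m) tendsto_id)
  have hxn : x = n := by
    have h1 : n ≤ x := le_of_tendsto_of_tendsto' hNlim hXlim hNX
    have h2 : 0 < ε := hpos i0 l0
    nlinarith
  refine ⟨n, ?_, fun i => tendsto_of_tendsto_of_tendsto_of_le_of_le hNlim (hxn ▸ hXlim)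
    (fun t => hN t i) (fun t => hX t i)⟩
  refine ge_of_tendsto' hNlim fun t => le_trans ?_ (hNmono (Nat.zero_le t))
  exact le_ciInf fun i => by simpa [w] using hδ i

/-- **Perron–Frobenius** for primitive matrices: the entries of the powers are asymptotic to
positive multiples of the powers of the Perron root. -/
theorem IsPrimitive.exists_tendsto_pow_div [Nonempty ι] {P : Matrix ι ι ℝ} (hP : P.IsPrimitive) :
    ∃ r : ℝ, 0 < r ∧ ∀ i j, ∃ c, 0 < c ∧
      Tendsto (fun t : ℕ => (P ^ t) i j / r ^ t) atTop (𝓝 c) := by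
  obtain ⟨r, hr, e, he, hPe⟩ := hP.exists_pos_eigenvector
  refine ⟨r, hr, fun i j => ?_⟩
  -- Conjugating by the diagonal matrix of `e` and dividing by `r` makes `P` stochastic.
  let Q : Matrix ι ι ℝ := of fun i j => P i j * e j / (r * e i)
  have hpow : ∀ (t : ℕ) i j, (Q ^ t) i j = (P ^ t) i j * e j / (r ^ t * e i) := by
    intro t
    induction t with
    | zero =>
      intro i j
      rcases eq_or_ne i j with rfl | hij
      · simp [(he i).ne']
      · simp [hij]
    | succ t ih =>
      intro i j
      simp only [pow_succ, mul_apply, Finset.sum_mul, Finset.sum_div, ih]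
      refine Finset.sum_congr rfl fun l _ => ?_
      simp only [Q, of_apply]
      have := (he i).ne'
      have := (he l).ne'
      field_simp
  have hQ : Q.IsPrimitive := by
    obtain ⟨hnn, m, hm, hpos⟩ := hP
    refine ⟨fun i j => ?_, m, hm, fun i j => ?_⟩
    · exact div_nonneg (mul_nonneg (hnn i j) (he j).le) (mul_pos hr (he i)).le
    · rw [hpow]
      exact div_pos (mul_pos (hpos i j) (he j)) (mul_pos (pow_pos hr m) (he i))
  have hone : ∀ i, ∑ j, Q i j = 1 := fun i => by
    have := congrFun hPe i
    simp only [Q, of_apply, ← Finset.sum_div]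
    rw [div_eq_one_iff_eq (mul_pos hr (he i)).ne']
    exact this
  -- Starting from a column of `Q ^ m`, not of the identity, bounds the limit below by a positive
  -- entry.
  obtain ⟨m, hm, hpos⟩ := hQ.exists_pos_pow
  obtain ⟨k, hk⟩ := Finite.exists_min fun i => (Q ^ m) i j
  obtain ⟨c, hc, hlim⟩ := tendsto_pow_mulVec_of_stochastic hQ hone (fun i => (Q ^ m) i j) hk
  refine ⟨c * (e i / e j), mul_pos ((hpos k j).trans_le hc) (div_pos (he i) (he j)), ?_⟩
  rw [← tendsto_add_atTop_iff_nat m]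
  refine ((hlim i).mul_const (e i / e j)).congr fun t => ?_
  have : (Q ^ t *ᵥ fun i => (Q ^ m) i j) i = (Q ^ (t + m)) i j := by
    rw [pow_add, mul_apply]; rfl
  rw [this, hpow]
  have := (he i).ne'
  have := (he j).ne'
  field_simp

end Matrix

/-! ### Polynomial scales -/

/-- The number of multisets of size `d` in a set of size `t + 1`, a polynomial in `t` of
degree `d`. -/
noncomputable def binomGrowth (d t : ℕ) : ℝ := ((t + d).choose d : ℝ)

theorem binomGrowth_pos (d t : ℕ) : 0 < binomGrowth d t :=
  Nat.cast_pos.2 (Nat.choose_pos (Nat.le_add_left d t))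

@[simp] theorem binomGrowth_zero (t : ℕ) : binomGrowth 0 t = 1 := by simp [binomGrowth]

theorem binomGrowth_mono (d : ℕ) : Monotone (binomGrowth d) := fun s t h => by
  unfold binomGrowth
  exact_mod_cast Nat.choose_le_choose d (Nat.add_le_add_right h d)

theorem binomGrowth_succ_mul (d t : ℕ) :
    binomGrowth (d + 1) t * (d + 1) = binomGrowth d t * (t + d + 1) := by
  have := Nat.add_one_mul_choose_eq (t + d) d
  unfold binomGrowth
  rw [mul_comm]
  rw [mul_comm, mul_comm (Nat.choose _ _ : ℝ) (_ + _ + _)]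
  rw [← add_assoc]
  exact_mod_cast this.symm

theorem binomGrowth_add_one_mul (d t : ℕ) :
    binomGrowth d (t + 1) * (t + 1) = binomGrowth d t * (t + 1 + d) := by
  have h := Nat.choose_mul_succ_eq (t + d) d
  have e : t + d + 1 - d = t + 1 := by lia
  rw [e] at h
  have e2 : t + 1 + d = t + d + 1 := by ring
  unfold binomGrowth
  rw [e2]
  have h' : (((t + d + 1).choose d * (t + 1) : ℕ) : ℝ) = ((t + d).choose d * (t + d + 1) : ℕ) := by
    rw [h]
  push_cast at h'
  linarith

/-- The hockey-stick identity: with binomials in place of powers of `t`, summation raises the degree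
exactly, with no lower-order terms. -/
theorem sum_range_binomGrowth (d t : ℕ) :
    ∑ s ∈ Finset.range (t + 1), binomGrowth d s = binomGrowth (d + 1) t := by
  induction t with
  | zero => simp [binomGrowth]
  | succ t ih =>
    rw [Finset.sum_range_succ, ih]
    unfold binomGrowth
    have e1 : t + 1 + (d + 1) = t + 1 + d + 1 := by ring
    have e2 : t + (d + 1) = t + 1 + d := by ring
    rw [e1, e2, Nat.choose_succ_succ', add_comm (Nat.choose _ _)]
    push_cast
    rfl

theorem tendsto_natCast_add_const_div (a b : ℝ) :
    Tendsto (fun t : ℕ => ((t : ℝ) + a) / (t + b)) atTop (𝓝 1) := by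
  have h : Tendsto (fun t : ℕ => 1 + (a - b) / ((t : ℝ) + b)) atTop (𝓝 (1 + 0)) :=
    tendsto_const_nhds.add (Tendsto.const_div_atTop
      (tendsto_atTop_add_const_right _ b tendsto_natCast_atTop_atTop) _)
  rw [add_zero] at h
  refine h.congr' ?_
  filter_upwards [(tendsto_atTop_add_const_right _ b
    tendsto_natCast_atTop_atTop).eventually_gt_atTop 0] with t ht
  have : (t : ℝ) + b ≠ 0 := ht.ne'
  field_simp
  ring

theorem tendsto_binomGrowth_div_succ (d : ℕ) :
    Tendsto (fun t => binomGrowth d t / binomGrowth (d + 1) t) atTop (𝓝 0) := by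
  have h : Tendsto (fun t : ℕ => ((d : ℝ) + 1) / ((t : ℝ) + (d + 1))) atTop (𝓝 0) :=
    Tendsto.const_div_atTop (tendsto_atTop_add_const_right _ _ tendsto_natCast_atTop_atTop) _
  refine h.congr fun t => ?_
  rw [div_eq_div_iff (by positivity) (binomGrowth_pos _ _).ne', ← add_assoc,
    ← binomGrowth_succ_mul]
  ring

theorem tendsto_binomGrowth_div_of_lt {d e : ℕ} (h : d < e) :
    Tendsto (fun t => binomGrowth d t / binomGrowth e t) atTop (𝓝 0) := by
  induction e, h using Nat.le_induction with
  | base => exact tendsto_binomGrowth_div_succ d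
  | succ e _ ih =>
    have := ih.mul (tendsto_binomGrowth_div_succ e)
    rw [mul_zero] at this
    refine this.congr fun t => ?_
    have := (binomGrowth_pos e t).ne'
    field_simp

theorem tendsto_binomGrowth_add_div (d s : ℕ) :
    Tendsto (fun t => binomGrowth d (t + s) / binomGrowth d t) atTop (𝓝 1) := by
  have h1 : Tendsto (fun t => binomGrowth d (t + 1) / binomGrowth d t) atTop (𝓝 1) := by
    refine (tendsto_natCast_add_const_div (1 + d) 1).congr fun t => ?_
    rw [div_eq_div_iff (by positivity) (binomGrowth_pos _ _).ne', ← add_assoc,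
      binomGrowth_add_one_mul]
    ring
  induction s with
  | zero => simp [(binomGrowth_pos d _).ne']
  | succ s ih =>
    have := (h1.comp (tendsto_add_atTop_nat s)).mul ih
    rw [mul_one] at this
    refine this.congr fun t => ?_
    have := (binomGrowth_pos d (t + s)).ne'
    simp only [Function.comp_apply, ← add_assoc]
    field_simp

theorem summable_binomGrowth_mul_pow (d : ℕ) {r : ℝ} (h0 : 0 ≤ r) (h1 : r < 1) :
    Summable fun t => binomGrowth d t * r ^ t :=
  summable_choose_mul_geometric_of_norm_lt_one d (by rwa [Real.norm_of_nonneg h0])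

/-! ### Asymptotics of Cauchy products -/

/-- The Cauchy product of two sequences. -/
def cauchyProd (a f : ℕ → ℝ) (t : ℕ) : ℝ := ∑ s ∈ Finset.range (t + 1), a s * f (t - s)

theorem cauchyProd_comm (a f : ℕ → ℝ) : cauchyProd a f = cauchyProd f a := by
  ext t
  unfold cauchyProd
  rw [← Finset.sum_range_reflect]
  refine Finset.sum_congr rfl fun s hs => ?_
  have : s ≤ t := Nat.lt_succ_iff.1 (Finset.mem_range.1 hs)
  rw [Nat.add_sub_cancel, Nat.sub_sub_self this, mul_comm]

theorem cauchyProd_div_pow (a f : ℕ → ℝ) (r : ℝ) (t : ℕ) :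
    cauchyProd (fun s => a s / r ^ s) (fun s => f s / r ^ s) t = cauchyProd a f t / r ^ t := by
  unfold cauchyProd
  rw [Finset.sum_div]
  refine Finset.sum_congr rfl fun s hs => ?_
  have : s ≤ t := Nat.lt_succ_iff.1 (Finset.mem_range.1 hs)
  rw [div_mul_div_comm, ← pow_add, Nat.add_sub_cancel' this]

theorem exists_abs_le_mul_binomGrowth {d : ℕ} {f : ℕ → ℝ} {γ : ℝ}
    (hf : Tendsto (fun t => f t / binomGrowth d t) atTop (𝓝 γ)) :
    ∃ C, 0 ≤ C ∧ ∀ t, |f t| ≤ C * binomGrowth d t := by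
  obtain ⟨C, hC⟩ := (Metric.isBounded_range_of_tendsto _ hf).exists_norm_le
  refine ⟨C, (norm_nonneg _).trans (hC _ ⟨0, rfl⟩), fun t => ?_⟩
  have := hC _ ⟨t, rfl⟩
  rwa [Real.norm_eq_abs, abs_div, abs_of_pos (binomGrowth_pos d t),
    div_le_iff₀ (binomGrowth_pos d t)] at this

/-- The Cauchy product of a summable sequence with a sequence of polynomial growth. -/
theorem tendsto_cauchyProd_of_summable {d : ℕ} {a f : ℕ → ℝ} {γ : ℝ}
    (ha : Summable fun s => |a s|)
    (hf : Tendsto (fun t => f t / binomGrowth d t) atTop (𝓝 γ)) :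
    Tendsto (fun t => cauchyProd a f t / binomGrowth d t) atTop (𝓝 ((∑' s, a s) * γ)) := by
  obtain ⟨C, hC0, hC⟩ := exists_abs_le_mul_binomGrowth hf
  -- Extension by zero fixes the index set, so dominated convergence applies with bound `|a s| * C`.
  let F : ℕ → ℕ → ℝ := fun t s => if s ≤ t then a s * f (t - s) / binomGrowth d t else 0
  have hF : ∀ t, cauchyProd a f t / binomGrowth d t = ∑' s, F t s := by
    intro t
    rw [tsum_eq_sum (s := Finset.range (t + 1))]
    · rw [cauchyProd, Finset.sum_div]
      refine Finset.sum_congr rfl fun s hs => ?_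
      simp [F, Nat.lt_succ_iff.1 (Finset.mem_range.1 hs)]
    · intro s hs
      have : ¬ s ≤ t := fun h => hs (Finset.mem_range.2 (Nat.lt_succ_iff.2 h))
      simp [F, this]
  simp only [hF]
  rw [← tsum_mul_right]
  refine tendsto_tsum_of_dominated_convergence (ha.mul_right C) (fun s => ?_)
    (Eventually.of_forall fun t s => ?_)
  · rw [← tendsto_add_atTop_iff_nat s]
    have h := (hf.mul ((tendsto_binomGrowth_add_div d s).inv₀ one_ne_zero)).const_mul (a s)
    rw [inv_one, mul_one] at h
    refine h.congr fun t => ?_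
    have := (binomGrowth_pos d t).ne'
    simp only [F, Nat.le_add_left, if_true, Nat.add_sub_cancel]
    field_simp
  · simp only [F]
    split_ifs with hst
    · rw [Real.norm_eq_abs, abs_div, abs_mul, abs_of_pos (binomGrowth_pos d t),
        div_le_iff₀ (binomGrowth_pos d t), mul_assoc]
      refine mul_le_mul_of_nonneg_left ((hC _).trans ?_) (abs_nonneg _)
      exact mul_le_mul_of_nonneg_left (binomGrowth_mono d (Nat.sub_le t s)) hC0
    · simpa using mul_nonneg (abs_nonneg _) hC0

/-- The Cauchy product of a convergent sequence with a sequence of polynomial growth. -/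
theorem tendsto_cauchyProd_of_tendsto {d : ℕ} {a f : ℕ → ℝ} {α γ : ℝ}
    (ha : Tendsto a atTop (𝓝 α))
    (hf : Tendsto (fun t => f t / binomGrowth d t) atTop (𝓝 γ)) :
    Tendsto (fun t => cauchyProd a f t / binomGrowth (d + 1) t) atTop (𝓝 (α * γ)) := by
  obtain ⟨C, hC0, hC⟩ := exists_abs_le_mul_binomGrowth hf
  have hsum : Tendsto (fun t => (∑ s ∈ Finset.range (t + 1), f s) / binomGrowth (d + 1) t)
      atTop (𝓝 γ) := by
    have h0 : (fun t => f t - γ * binomGrowth d t) =o[atTop] binomGrowth d := by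
      rw [Asymptotics.isLittleO_iff_tendsto fun t h => absurd h (binomGrowth_pos d t).ne']
      have := hf.sub_const γ
      rw [sub_self] at this
      refine this.congr fun t => ?_
      have := (binomGrowth_pos d t).ne'
      field_simp
    have htop : Tendsto (fun t => ∑ s ∈ Finset.range t, binomGrowth d s) atTop atTop := by
      refine tendsto_atTop_mono (fun t => ?_) (tendsto_natCast_atTop_atTop (R := ℝ))
      calc (t : ℝ) = ∑ s ∈ Finset.range t, binomGrowth d 0 := by simp [binomGrowth]
        _ ≤ _ := Finset.sum_le_sum fun s _ => binomGrowth_mono d (Nat.zero_le s)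
    have h1 := ((h0.sum_range (fun t => (binomGrowth_pos d t).le) htop).tendsto_div_nhds_zero.comp
      (tendsto_add_atTop_nat 1)).add_const γ
    rw [zero_add] at h1
    refine h1.congr fun t => ?_
    have := (binomGrowth_pos (d + 1) t).ne'
    simp only [Function.comp_apply, Finset.sum_sub_distrib, ← Finset.mul_sum,
      sum_range_binomGrowth]
    field_simp
    ring
  -- The error is bounded by a constant times the Cesàro mean of `|a s - α|`.
  have herr : Tendsto (fun t => cauchyProd (fun s => a s - α) f t / binomGrowth (d + 1) t)
      atTop (𝓝 0) := by
    have hε : Tendsto (fun s => |a s - α|) atTop (𝓝 0) := by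
      simpa using (ha.sub_const α).abs
    have h1 := ((hε.cesaro.comp (tendsto_add_atTop_nat 1)).const_mul (C * (d + 1)))
    rw [mul_zero] at h1
    refine squeeze_zero_norm (fun t => ?_) h1
    simp only [Function.comp_apply, cauchyProd]
    rw [Real.norm_eq_abs, abs_div, abs_of_pos (binomGrowth_pos _ t),
      div_le_iff₀ (binomGrowth_pos _ t)]
    set E := ∑ s ∈ Finset.range (t + 1), |a s - α|
    have hE : 0 ≤ E := Finset.sum_nonneg fun s _ => abs_nonneg _
    have hB := binomGrowth_succ_mul d t
    calc |∑ s ∈ Finset.range (t + 1), (a s - α) * f (t - s)|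
        ≤ ∑ s ∈ Finset.range (t + 1), |a s - α| * (C * binomGrowth d t) := by
          refine (Finset.abs_sum_le_sum_abs _ _).trans (Finset.sum_le_sum fun s _ => ?_)
          rw [abs_mul]
          refine mul_le_mul_of_nonneg_left ((hC _).trans ?_) (abs_nonneg _)
          exact mul_le_mul_of_nonneg_left (binomGrowth_mono d (Nat.sub_le t s)) hC0
      _ = C * E * binomGrowth d t := by rw [← Finset.sum_mul]; ring
      _ ≤ C * E * (binomGrowth d t * ((t + d + 1) / (t + 1))) := by
          refine mul_le_mul_of_nonneg_left ?_ (mul_nonneg hC0 hE)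
          refine le_mul_of_one_le_right (binomGrowth_pos d t).le ?_
          rw [one_le_div (by positivity)]
          have : (0 : ℝ) ≤ d := Nat.cast_nonneg d
          linarith
      _ = C * (d + 1) * (((t + 1 : ℕ) : ℝ)⁻¹ * E) * binomGrowth (d + 1) t := by
          push_cast
          rw [mul_div_assoc', ← hB]
          field_simp
  have h := (hsum.const_mul α).add herr
  rw [add_zero] at h
  refine h.congr fun t => ?_
  rw [mul_div_assoc', ← add_div]
  congr 1
  have : cauchyProd (fun s => a s - α) f t
      = cauchyProd a f t - α * ∑ s ∈ Finset.range (t + 1), f (t - s) := by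
    simp only [cauchyProd, sub_mul, Finset.sum_sub_distrib, Finset.mul_sum]
  have hr : ∑ s ∈ Finset.range (t + 1), f (t - s) = ∑ s ∈ Finset.range (t + 1), f s := by
    simpa using Finset.sum_range_reflect f (t + 1)
  rw [this, hr]
  ring

/-! ### Regularly growing sequences -/

/-- `u` is asymptotic to `c` times the scale `t ↦ binomGrowth d t * r ^ t`. -/
def HasGrowth (u : ℕ → ℝ) (d : ℕ) (r c : ℝ) : Prop :=
  Tendsto (fun t => u t / (binomGrowth d t * r ^ t)) atTop (𝓝 c)

/-- `u` vanishes eventually or is asymptotic to a positive multiple of a scale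
`t ↦ binomGrowth d t * r ^ t` with `0 < r`. -/
def RegularGrowth (u : ℕ → ℝ) : Prop :=
  (∀ᶠ t in atTop, u t = 0) ∨ ∃ d r c, 0 < r ∧ 0 < c ∧ HasGrowth u d r c

theorem binomGrowth_mul_pow_ne_zero (d t : ℕ) {r : ℝ} (hr : 0 < r) :
    binomGrowth d t * r ^ t ≠ 0 :=
  (mul_pos (binomGrowth_pos d t) (pow_pos hr t)).ne'

theorem tendsto_scale_div_of_lt (d e : ℕ) {r s : ℝ} (hr : 0 < r) (hrs : r < s) :
    Tendsto (fun t => (binomGrowth d t * r ^ t) / (binomGrowth e t * s ^ t)) atTop (𝓝 0) := by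
  have hs := hr.trans hrs
  refine squeeze_zero (fun t => ?_) (fun t => ?_) (summable_binomGrowth_mul_pow d
    (div_nonneg hr.le hs.le) ((div_lt_one hs).2 hrs)).tendsto_atTop_zero
  · exact (div_pos (mul_pos (binomGrowth_pos d t) (pow_pos hr t))
      (mul_pos (binomGrowth_pos e t) (pow_pos hs t))).le
  · rw [div_pow, mul_div_assoc']
    refine div_le_div_of_nonneg_left (mul_pos (binomGrowth_pos d t) (pow_pos hr t)).le
      (pow_pos hs t) (le_mul_of_one_le_left (pow_pos hs t).le ?_)
    calc (1 : ℝ) = binomGrowth e 0 := by simp [binomGrowth]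
      _ ≤ _ := binomGrowth_mono e (Nat.zero_le t)

theorem scale_trichotomy (d e : ℕ) {r s : ℝ} (hr : 0 < r) (hs : 0 < s) :
    Tendsto (fun t => (binomGrowth d t * r ^ t) / (binomGrowth e t * s ^ t)) atTop (𝓝 0) ∨
    (d = e ∧ r = s) ∨
    Tendsto (fun t => (binomGrowth e t * s ^ t) / (binomGrowth d t * r ^ t)) atTop (𝓝 0) := by
  rcases lt_trichotomy r s with h | rfl | h
  · exact Or.inl (tendsto_scale_div_of_lt d e hr h)
  · simp only [mul_div_mul_right _ _ (pow_pos hr _).ne']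
    rcases lt_trichotomy d e with h | rfl | h
    · exact Or.inl (tendsto_binomGrowth_div_of_lt h)
    · simp
    · exact Or.inr (Or.inr (tendsto_binomGrowth_div_of_lt h))
  · exact Or.inr (Or.inr (tendsto_scale_div_of_lt e d hs h))

theorem HasGrowth.trans_zero {u : ℕ → ℝ} {d e : ℕ} {r s c : ℝ} (hu : HasGrowth u d r c)
    (hr : 0 < r)
    (h : Tendsto (fun t => (binomGrowth d t * r ^ t) / (binomGrowth e t * s ^ t)) atTop (𝓝 0)) :
    HasGrowth u e s 0 := by
  have := hu.mul h
  rw [mul_zero] at this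
  refine this.congr fun t => ?_
  have := binomGrowth_mul_pow_ne_zero d t hr
  rw [div_mul_div_cancel₀ this]

theorem HasGrowth.add {u v : ℕ → ℝ} {d : ℕ} {r c c' : ℝ} (hu : HasGrowth u d r c)
    (hv : HasGrowth v d r c') : HasGrowth (fun t => u t + v t) d r (c + c') := by
  unfold HasGrowth
  simp only [add_div]
  exact Tendsto.add hu hv

theorem HasGrowth.congr' {u v : ℕ → ℝ} {d : ℕ} {r c : ℝ} (hu : HasGrowth u d r c)
    (h : u =ᶠ[atTop] v) : HasGrowth v d r c :=
  Tendsto.congr' (h.mono fun t ht => by simp only [ht]) hu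

theorem HasGrowth.of_shift {u : ℕ → ℝ} {d : ℕ} {r c : ℝ} (hr : 0 < r)
    (h : HasGrowth (fun t => u (t + 1)) d r c) : HasGrowth u d r (c / r) := by
  unfold HasGrowth
  rw [← tendsto_add_atTop_iff_nat 1]
  have := (Tendsto.mul h ((tendsto_binomGrowth_add_div d 1).inv₀ one_ne_zero)).div_const r
  rw [inv_one, mul_one] at this
  refine this.congr fun t => ?_
  have := (binomGrowth_pos d t).ne'
  have := (binomGrowth_pos d (t + 1)).ne'
  rw [pow_succ]
  field_simp

namespace RegularGrowth

theorem zero : RegularGrowth fun _ => 0 := Or.inl (Eventually.of_forall fun _ => rfl)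

theorem congr' {u v : ℕ → ℝ} (hu : RegularGrowth u) (h : u =ᶠ[atTop] v) : RegularGrowth v := by
  rcases hu with hu | ⟨d, r, c, hr, hc, hu⟩
  · exact Or.inl (by filter_upwards [hu, h] with t h1 h2; rw [← h2, h1])
  · exact Or.inr ⟨d, r, c, hr, hc, hu.congr' h⟩

/-- The dominant scale survives; for equal scales the positive constants cannot cancel. -/
theorem add {u v : ℕ → ℝ} (hu : RegularGrowth u) (hv : RegularGrowth v) :
    RegularGrowth fun t => u t + v t := by
  rcases hu with hu0 | ⟨d, r, c, hr, hc, hu⟩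
  · exact hv.congr' (by filter_upwards [hu0] with t ht; rw [ht, zero_add])
  rcases hv with hv0 | ⟨e, s, c', hs, hc', hv⟩
  · exact congr' (Or.inr ⟨d, r, c, hr, hc, hu⟩)
      (by filter_upwards [hv0] with t ht; rw [ht, add_zero])
  rcases scale_trichotomy d e hr hs with h | ⟨rfl, rfl⟩ | h
  · exact Or.inr ⟨e, s, 0 + c', hs, by simpa, (hu.trans_zero hr h).add hv⟩
  · exact Or.inr ⟨d, r, c + c', hr, add_pos hc hc', hu.add hv⟩
  · exact Or.inr ⟨d, r, c + 0, hr, by simpa, hu.add (hv.trans_zero hs h)⟩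

theorem const_mul {u : ℕ → ℝ} (hu : RegularGrowth u) {a : ℝ} (ha : 0 ≤ a) :
    RegularGrowth fun t => a * u t := by
  rcases ha.eq_or_lt with rfl | ha
  · simpa using zero
  rcases hu with hu0 | ⟨d, r, c, hr, hc, hu⟩
  · exact Or.inl (hu0.mono fun t ht => by simp [ht])
  · refine Or.inr ⟨d, r, a * c, hr, mul_pos ha hc, ?_⟩
    unfold HasGrowth
    simp only [mul_div_assoc]
    exact Tendsto.const_mul a hu

theorem sum {ι : Type*} (s : Finset ι) {u : ι → ℕ → ℝ} (h : ∀ i ∈ s, RegularGrowth (u i)) :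
    RegularGrowth fun t => ∑ i ∈ s, u i t := by
  classical
  induction s using Finset.induction_on with
  | empty => simpa using zero
  | insert i s hi ih =>
    simp only [Finset.sum_insert hi]
    exact (h i (Finset.mem_insert_self i s)).add
      (ih fun j hj => h j (Finset.mem_insert_of_mem hj))

theorem of_shift {u : ℕ → ℝ} (h : RegularGrowth fun t => u (t + 1)) : RegularGrowth u := by
  rcases h with h | ⟨d, r, c, hr, hc, h⟩
  · refine Or.inl ?_
    obtain ⟨N, hN⟩ := eventually_atTop.1 h
    refine eventually_atTop.2 ⟨N + 1, fun t ht => ?_⟩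
    obtain ⟨k, rfl⟩ := Nat.exists_eq_add_of_le ht
    rw [add_right_comm]
    exact hN (N + k) (Nat.le_add_right N k)
  · exact Or.inr ⟨d, r, c / r, hr, div_pos hc hr, h.of_shift hr⟩

/-- The Cauchy product of a regularly growing sequence with an asymptotically geometric one grows
regularly. -/
theorem cauchyProd {a f : ℕ → ℝ} {l α : ℝ} (hl : 0 < l) (hα : 0 < α) (ha0 : ∀ t, 0 ≤ a t)
    (ha : Tendsto (fun t => a t / l ^ t) atTop (𝓝 α)) (hf0 : ∀ t, 0 ≤ f t)
    (hf : RegularGrowth f) : RegularGrowth (cauchyProd a f) := by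
  have ha' : HasGrowth a 0 l α := by simpa [HasGrowth] using ha
  have hscale : ∀ {d : ℕ} {r γ : ℝ}, HasGrowth f d r γ →
      Tendsto (fun t => f t / r ^ t / binomGrowth d t) atTop (𝓝 γ) := fun {d r γ} h => by
    refine Tendsto.congr (fun t => ?_) h
    rw [div_div, mul_comm]
  have hres : ∀ {d : ℕ} {r γ : ℝ}, 0 < r → 0 < γ → Tendsto (fun t => _root_.cauchyProd
      (fun s => a s / r ^ s) (fun s => f s / r ^ s) t / binomGrowth d t) atTop (𝓝 γ) →
      RegularGrowth (_root_.cauchyProd a f) := fun {d r γ} hr hγ h => by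
    refine Or.inr ⟨d, r, γ, hr, hγ, Tendsto.congr (fun t => ?_) h⟩
    rw [cauchyProd_div_pow, div_div, mul_comm]
  have hsummable : ∀ {u : ℕ → ℝ} {d : ℕ} {r s c : ℝ}, 0 < r → r < s → HasGrowth u d r c →
      Summable fun t => |u t / s ^ t| := fun {u d r s c} hr hrs h => by
    have hs := hr.trans hrs
    have h' : Tendsto (fun t => u t / r ^ t / binomGrowth d t) atTop (𝓝 c) :=
      Tendsto.congr (fun t => by rw [div_div, mul_comm]) h
    obtain ⟨C, hC0, hC⟩ := exists_abs_le_mul_binomGrowth h'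
    refine Summable.of_nonneg_of_le (fun t => abs_nonneg _) (fun t => ?_)
      ((summable_binomGrowth_mul_pow d (div_nonneg hr.le hs.le) ((div_lt_one hs).2 hrs)).mul_left C)
    have e : u t / s ^ t = u t / r ^ t * (r / s) ^ t := by
      have := (pow_pos hr t).ne'
      rw [div_pow]
      field_simp
    rw [e, abs_mul, abs_of_pos (pow_pos (div_pos hr hs) t), ← mul_assoc]
    exact mul_le_mul_of_nonneg_right (hC t) (pow_pos (div_pos hr hs) t).le
  have htsum : ∀ {u : ℕ → ℝ} {s : ℝ}, 0 < s → (∀ t, 0 ≤ u t) → (∃ t, u t ≠ 0) →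
      Summable (fun t => |u t / s ^ t|) → 0 < ∑' t, u t / s ^ t := fun {u s} hs h0 h h' => by
    obtain ⟨t, ht⟩ := h
    exact h'.of_abs.tsum_pos (fun t => div_nonneg (h0 t) (pow_pos hs t).le) t
      (div_pos (lt_of_le_of_ne (h0 t) ht.symm) (pow_pos hs t))
  by_cases hfz : ∀ t, f t = 0
  · refine Or.inl (Eventually.of_forall fun t => ?_)
    simp [_root_.cauchyProd, hfz]
  push Not at hfz
  -- Here the rate `l` of `a` wins: `f / l ^ t` is the summable factor and `a / l ^ t` the
  -- convergent one, so the degree is 0.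
  have hlow : Summable (fun t => |f t / l ^ t|) → RegularGrowth (_root_.cauchyProd a f) := by
    intro hs
    refine hres (d := 0) hl (mul_pos (htsum hl hf0 hfz hs) hα) ?_
    rw [cauchyProd_comm]
    exact tendsto_cauchyProd_of_summable hs (by simpa using ha)
  rcases hf with hf | ⟨d, r, γ, hr, hγ, hf⟩
  · obtain ⟨N, hN⟩ := eventually_atTop.1 hf
    refine hlow (summable_of_ne_finset_zero (s := Finset.range N) fun t ht => ?_)
    rw [hN t (by simpa using ht)]
    simp
  rcases lt_trichotomy r l with h | rfl | h
  · exact hlow (hsummable hr h hf)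
  · exact hres hr (mul_pos hα hγ) (tendsto_cauchyProd_of_tendsto ha (hscale hf))
  · have hs := hsummable hl h ha'
    have hane : ∃ t, a t ≠ 0 := by
      obtain ⟨t, ht⟩ := (ha.eventually (lt_mem_nhds hα)).exists
      exact ⟨t, fun h => by simp [h] at ht⟩
    exact hres hr (mul_pos (htsum hr ha0 hane hs) hγ)
      (tendsto_cauchyProd_of_summable hs (hscale hf))

/-- A nonnegative regularly growing sequence dominated by another one has a limit relative
to it. -/
theorem exists_tendsto_div {x h : ℕ → ℝ} (hx : RegularGrowth x) (hh : RegularGrowth h)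
    (hxh : ∀ t, x t ≤ h t) (hpos : ∀ t, 0 < h t) :
    ∃ c, Tendsto (fun t => x t / h t) atTop (𝓝 c) := by
  rcases hh with hh | ⟨e, s, c', hs, hc', hh⟩
  · obtain ⟨t, ht⟩ := hh.exists
    exact absurd ht (hpos t).ne'
  have key : ∀ c, HasGrowth x e s c → ∃ c, Tendsto (fun t => x t / h t) atTop (𝓝 c) := by
    intro c hxc
    refine ⟨c / c', (Tendsto.div hxc hh hc'.ne').congr fun t => ?_⟩
    exact div_div_div_cancel_right₀ (binomGrowth_mul_pow_ne_zero e t hs) _ _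
  rcases hx with hx | ⟨d, r, c, hr, hc, hx⟩
  · refine ⟨0, tendsto_const_nhds.congr' ?_⟩
    filter_upwards [hx] with t ht
    rw [ht, zero_div]
  rcases scale_trichotomy d e hr hs with hlt | ⟨rfl, rfl⟩ | hgt
  · exact key 0 (hx.trans_zero hr hlt)
  · exact key c hx
  -- If `x` had the larger scale, dividing `x ≤ h` by it would force its leading constant to be
  -- nonpositive.
  · have : c ≤ 0 := le_of_tendsto_of_tendsto' hx (hh.trans_zero hs hgt) fun t =>
      div_le_div_of_nonneg_right (hxh t) (mul_pos (binomGrowth_pos d t) (pow_pos hr t)).le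
    exact absurd hc (not_lt.2 this)

end RegularGrowth

/-! ### Block recurrences -/

namespace Matrix

variable {ι : Type*} [Fintype ι] [DecidableEq ι]

/-- Variation of constants for a linear recurrence. -/
theorem recurrence_solution {P : Matrix ι ι ℝ} {y g : ℕ → ι → ℝ}
    (h : ∀ t, y (t + 1) = P *ᵥ y t + g t) (t : ℕ) :
    y (t + 1) = P ^ (t + 1) *ᵥ y 0 + ∑ s ∈ Finset.range (t + 1), P ^ s *ᵥ g (t - s) := by
  induction t with
  | zero => simp [h]
  | succ t ih =>
    rw [h (t + 1), ih, Finset.sum_range_succ' _ (t + 1), mulVec_add, mulVec_mulVec, ← pow_succ',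
      mulVec_sum]
    simp only [mulVec_mulVec, ← pow_succ', pow_zero, one_mulVec, Nat.sub_zero,
      Nat.add_sub_add_right, add_assoc]

/-- A recurrence with primitive matrix and regularly growing inhomogeneity has regularly growing
solutions. -/
theorem IsPrimitive.regularGrowth_recurrence {P : Matrix ι ι ℝ} (hP : P.IsPrimitive)
    {y g : ℕ → ι → ℝ} (h : ∀ t, y (t + 1) = P *ᵥ y t + g t) (hy : ∀ i, 0 ≤ y 0 i)
    (hg0 : ∀ t i, 0 ≤ g t i) (hg : ∀ i, RegularGrowth fun t => g t i) (i : ι) :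
    RegularGrowth fun t => y t i := by
  have : Nonempty ι := ⟨i⟩
  obtain ⟨r, hr, hlim⟩ := hP.exists_tendsto_pow_div
  refine RegularGrowth.of_shift ?_
  have hsol : (fun t => y (t + 1) i) = fun t => (∑ j, y 0 j * (P ^ (t + 1)) i j) +
      ∑ j, cauchyProd (fun s => (P ^ s) i j) (fun s => g s j) t := by
    ext t
    rw [recurrence_solution h t, Pi.add_apply, Finset.sum_apply]
    simp only [mulVec, dotProduct, cauchyProd]
    rw [Finset.sum_comm]
    simp only [mul_comm]
  rw [hsol]
  refine RegularGrowth.add (RegularGrowth.sum _ fun j _ => ?_) (RegularGrowth.sum _ fun j _ => ?_)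
  · obtain ⟨c, hc, hlim⟩ := hlim i j
    refine RegularGrowth.const_mul (Or.inr ⟨0, r, c * r, hr, mul_pos hc hr, ?_⟩) (hy j)
    refine ((hlim.comp (tendsto_add_atTop_nat 1)).mul_const r).congr fun t => ?_
    simp only [Function.comp_apply, binomGrowth_zero, one_mul, pow_succ r]
    field_simp
  · obtain ⟨c, hc, hlim⟩ := hlim i j
    exact RegularGrowth.cauchyProd hr hc (fun t => pow_apply_nonneg hP.nonneg t i j) hlim
      (fun t => hg0 t j) (hg j)

end Matrix

theorem IsPrimitiveFrobenius.regularGrowth {n k : ℕ} {M : Matrix (Fin n) (Fin n) ℝ}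
    {b : Fin n → Fin k} (hform : IsPrimitiveFrobenius M b) (hnonneg : ∀ i j, 0 ≤ M i j)
    {v : Fin n → ℝ} (hv : ∀ i, 0 ≤ v i) (i : Fin n) :
    RegularGrowth fun t => (M ^ t *ᵥ v) i := by
  obtain ⟨a, ha⟩ : ∃ a, b i = a := ⟨_, rfl⟩
  induction a using WellFoundedLT.induction generalizing i with
  | ind a ih =>
  set x : ℕ → Fin n → ℝ := fun t => M ^ t *ᵥ v
  have hx : ∀ t i, 0 ≤ x t i := fun t i =>
    Matrix.mulVec_nonneg_of_nonneg (Matrix.pow_apply_nonneg hnonneg t) hv i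
  let y : ℕ → {i // b i = a} → ℝ := fun t i => x t i
  let g : ℕ → {i // b i = a} → ℝ := fun t i => ∑ j with b j < a, M i j * x t j
  have hg : ∀ i, RegularGrowth fun t => g t i := fun i =>
    RegularGrowth.sum _ fun j hj =>
      (ih (b j) (Finset.mem_filter.1 hj).2 j rfl).const_mul (hnonneg i j)
  have hrec : ∀ t, y (t + 1) = M.toSquareBlock b a *ᵥ y t + g t := by
    intro t
    ext i
    have h1 : x (t + 1) i = ∑ j, M i j * x t j := by
      simp only [x, pow_succ', ← Matrix.mulVec_mulVec]
      rfl
    have h2 : (M.toSquareBlock b a *ᵥ y t) i = ∑ j with b j = a, M i j * x t j := by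
      rw [← Finset.sum_subtype_eq_sum_filter, Finset.subtype_univ]
      rfl
    have h3 : ∑ j with ¬ b j = a, M i j * x t j = g t i := by
      symm
      refine Finset.sum_subset (fun j hj => ?_) fun j hj hj' => ?_
      · simp only [Finset.mem_filter, Finset.mem_univ, true_and] at hj ⊢
        exact hj.ne
      · simp only [Finset.mem_filter, Finset.mem_univ, true_and] at hj hj'
        rw [hform.lower_triangular i j, zero_mul]
        rw [i.2]
        exact lt_of_le_of_ne (not_lt.1 hj') (Ne.symm hj)
    rw [Pi.add_apply, h2, ← h3, Finset.sum_filter_add_sum_filter_not]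
    exact h1
  rcases hform.diagonal a with hP | ⟨-, hzero⟩
  · exact hP.regularGrowth_recurrence hrec (fun i => hx 0 i)
      (fun t i => Finset.sum_nonneg fun j _ => mul_nonneg (hnonneg i j) (hx t j)) hg ⟨i, ha⟩
  -- For a zero block the recurrence reads `y (t + 1) = g t`.
  · refine RegularGrowth.of_shift ((hg ⟨i, ha⟩).congr' (Eventually.of_forall fun t => ?_))
    have := congrFun (hrec t) ⟨i, ha⟩
    rw [hzero, Matrix.zero_mulVec, zero_add] at this
    exact this.symm

/-! ### Normalization and the limit eigenvector -/

theorem Matrix.pow_mulVec_ne_zero_of_col_ne_zero {ι : Type*} [Fintype ι] [DecidableEq ι]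
    {M : Matrix ι ι ℝ} (hnonneg : ∀ i j, 0 ≤ M i j) (hcol : ∀ j, ∃ i, M i j ≠ 0)
    {v : ι → ℝ} (hv : ∀ i, 0 ≤ v i) (hv0 : v ≠ 0) (t : ℕ) : M ^ t *ᵥ v ≠ 0 := by
  induction t with
  | zero => simpa
  | succ t ih =>
    obtain ⟨j, hj⟩ := Function.ne_iff.1 ih
    obtain ⟨i, hi⟩ := hcol j
    have hx : ∀ i, 0 ≤ (M ^ t *ᵥ v) i :=
      mulVec_nonneg_of_nonneg (pow_apply_nonneg hnonneg t) hv
    rw [pow_succ', ← mulVec_mulVec]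
    refine Function.ne_iff.2 ⟨i, ne_of_gt ?_⟩
    exact Finset.sum_pos' (fun l _ => mul_nonneg (hnonneg i l) (hx l)) ⟨j, Finset.mem_univ j,
      mul_pos (lt_of_le_of_ne (hnonneg i j) hi.symm) (lt_of_le_of_ne (hx j) hj.symm)⟩

/-- If the orbit of `v`, normalized by its coordinate sum, converges, the limit is an
eigenvector. -/
theorem Matrix.mulVec_eq_smul_of_tendsto_normalized {ι : Type*} [Fintype ι] [DecidableEq ι]
    {M : Matrix ι ι ℝ} {v w : ι → ℝ} (hpos : ∀ t, 0 < ∑ i, (M ^ t *ᵥ v) i)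
    (hw : Tendsto (fun t => (∑ i, (M ^ t *ᵥ v) i)⁻¹ • (M ^ t *ᵥ v)) atTop (𝓝 w)) :
    ∑ i, w i = 1 ∧ M *ᵥ w = (∑ i, (M *ᵥ w) i) • w := by
  set h : ℕ → ℝ := fun t => ∑ i, (M ^ t *ᵥ v) i
  have hsum : Continuous fun u : ι → ℝ => ∑ i, u i := by fun_prop
  have hmul : Continuous fun u : ι → ℝ => M *ᵥ u := by fun_prop
  have h1 : ∑ i, w i = 1 := by
    refine tendsto_nhds_unique ((hsum.tendsto w).comp hw) (tendsto_const_nhds.congr fun t => ?_)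
    simp only [Function.comp_apply, Pi.smul_apply, smul_eq_mul, ← Finset.mul_sum]
    exact (inv_mul_cancel₀ (hpos t).ne').symm
  have hMw := (hmul.tendsto w).comp hw
  have hstep : ∀ t, M *ᵥ ((h t)⁻¹ • (M ^ t *ᵥ v)) = (h t)⁻¹ • (M ^ (t + 1) *ᵥ v) := fun t => by
    rw [mulVec_smul, mulVec_mulVec, ← pow_succ']
  refine ⟨h1, tendsto_nhds_unique hMw ?_⟩
  -- The image under `M` of the normalized vector at time `t` is the one at time `t + 1` scaled by
  -- `h (t + 1) / h t`, which is that image's coordinate sum.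
  refine (((hsum.tendsto _).comp hMw).smul (hw.comp (tendsto_add_atTop_nat 1))).congr fun t => ?_
  simp only [Function.comp_apply]
  rw [hstep]
  simp only [Pi.smul_apply, smul_eq_mul, ← Finset.mul_sum]
  rw [smul_smul, mul_assoc, mul_inv_cancel₀ (hpos (t + 1)).ne', mul_one]

theorem theorem5p1 {n k : ℕ} (M : Matrix (Fin n) (Fin n) ℝ) (b : Fin n → Fin k)
    (hnonneg : ∀ i j, 0 ≤ M i j)
    (hform : IsPrimitiveFrobenius M b)
    (hcol : ∀ j, ∃ i, M i j ≠ 0)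
    (v : Fin n → ℝ) (hv : ∀ i, 0 ≤ v i) (hv0 : v ≠ 0) :
    ∃ (h : ℕ → ℝ) (w : Fin n → ℝ),
      IsNormalizationWithLimit h (fun t => (M ^ t) *ᵥ v) w ∧
      ∃ μ : ℝ, Module.End.HasEigenvector (Matrix.toLin' M) μ w := by
  have hx : ∀ t i, 0 ≤ (M ^ t *ᵥ v) i := fun t =>
    Matrix.mulVec_nonneg_of_nonneg (Matrix.pow_apply_nonneg hnonneg t) hv
  have hpos : ∀ t, 0 < ∑ i, (M ^ t *ᵥ v) i := fun t => by
    obtain ⟨i, hi⟩ := Function.ne_iff.1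
      (Matrix.pow_mulVec_ne_zero_of_col_ne_zero hnonneg hcol hv hv0 t)
    exact Finset.sum_pos' (fun i _ => hx t i)
      ⟨i, Finset.mem_univ i, lt_of_le_of_ne (hx t i) (Ne.symm hi)⟩
  have hreg := hform.regularGrowth hnonneg hv
  choose w hw using fun i => (hreg i).exists_tendsto_div
    (RegularGrowth.sum Finset.univ fun j _ => hreg j)
    (fun t => Finset.single_le_sum (fun j _ => hx t j) (Finset.mem_univ i)) hpos
  have hlim : Tendsto (fun t => (∑ i, (M ^ t *ᵥ v) i)⁻¹ • (M ^ t *ᵥ v)) atTop (𝓝 w) :=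
    tendsto_pi_nhds.2 fun i => (hw i).congr fun t => by
      rw [Pi.smul_apply, smul_eq_mul, div_eq_inv_mul]
  obtain ⟨hw1, hMw⟩ := Matrix.mulVec_eq_smul_of_tendsto_normalized hpos hlim
  have hw0 : w ≠ 0 := by
    rintro rfl
    simp at hw1
  exact ⟨_, w, ⟨hw0, hlim⟩, _, Module.End.mem_eigenspace_iff.2 hMw, hw0⟩
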